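/- Fix a field $k$; $H_i$ denotes singular homology with coefficients in $k$, $i\in\mathbb Z$ (zero for $i<0$). A *size pair* $(X,\vec f)$ is a non-empty, compact, locally connected Hausdorff space $X$ with a continuous function $\vec f=(f_1,\dots,f_n):X\to\mathbb R^n$. For $\varphi:X\to\mathbb R$ write $X\langle\varphi\le s\rangle=\{P\in X:\varphi(P)\le s\}$. A real number $a$ is a *homological critical value* of $\varphi$ if for some $i$ the inclusion-induced map $H_i(X\langle\varphi\le a-\varepsilon\rangle)\to H_i(X\langle\varphi\le a+\varepsilon\rangle)$ is not an isomorphism for all sufficiently small $\varepsilon>0$; $\varphi$ is *tame* if it has finitely many homological critical values and $H_i(X\langle\varphi\le a\rangle)$ is finite-dimensional for all $i\in\mathbb Z$, $a\in\mathbb R$. A pair $(\vec l,\vec b)\in\mathbb R^n\times\mathbb R^n$ is *admissible*, $(\vec l,\vec b)\in Adm_n$, if $\vec l$ is a Euclidean unit vector with all $l_j>0$ and $\sum_j b_j=0$. For such a pair put $f_{(\vec l,\vec b)}(P)=\max_{j}\frac{f_j(P)-b_j}{l_j}$. The continuous function $\vec f$ is *max-tame* if $f_{(\vec l,\vec b)}$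 is tame for every admissible pair. The *$i$-th rank invariant* of $\varphi:X\to\mathbb R$ is $\rho^{\varphi}_{X,i}(s,t)=\operatorname{rank}\big(H_i(X\langle\varphi\le s\rangle)\to H_i(X\langle\varphi\le t\rangle)\big)$ for $s<t$; for $\vec f$ the rank invariant $\overline\rho^{\vec f}_{X,i}(\vec u,\vec v)$ is defined in the same way with the coordinatewise order on $\mathbb R^n$, and $\overline\rho^{\vec f}_{X,i}(s\vec l+\vec b,\,t\vec l+\vec b)=\rho^{f_{(\vec l,\vec b)}}_{X,i}(s,t)$. The multiplicity of $(x,y)$, $x<y<\infty$, as a cornerpoint of $\rho$ is the minimum, over $\varepsilon>0$ with $x+\varepsilon<y-\varepsilon$, of $\rho(x+\varepsilon,y-\varepsilon)-\rho(x-\varepsilon,y-\varepsilon)-\rho(x+\varepsilon,y+\varepsilon)+\rho(x-\varepsilon,y+\varepsilon)$; that of $(x,\infty)$ is the minimum, over $\varepsilon>0$ and $t>x+\varepsilon$, of $\rho(x+\varepsilon,t)-\rho(x-\varepsilon,t)$. The *persistence diagram* $C_\rho$ is the multiset of cornerpoints of $\rho$ with these multiplicities, augmented by countably infinitely many points of the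 diagonal $y=x$. The *matching distance* is $$d(\rho,\rho')=\inf_{\sigma}\ \sup_{P\in C_\rho}\delta(P,\sigma(P))\in[0,\infty],$$ where $\sigma$ ranges over all bijections $C_\rho\to C_{\rho'}$ and $$\delta\big((a,b),(c,d)\big)=\min\Big\{\max\{|a-c|,|b-d|\},\ \max\big\{\tfrac{b-a}2,\tfrac{d-c}2\big\}\Big\},$$ with $|\infty-\infty|=0$ and $|\infty-y|=\infty-x=\infty$ for $x,y\in\mathbb R$. The *$i$-th multidimensional matching distance* is $$D\big(\overline\rho^{\vec f}_{X,i},\overline\rho^{\vec h}_{Y,i}\big)=\sup_{(\vec l,\vec b)\in Adm_n}\ \Big(\min_{j}l_j\Big)\cdot d\Big(\rho^{f_{(\vec l,\vec b)}}_{X,i},\rho^{h_{(\vec l,\vec b)}}_{Y,i}\Big)\in[0,\infty].$$ **Proposition 4.2.** Let $(X,\vec f)$ and $(Y,\vec h)$ be size pairs with $\vec f=(f_1,\dots,f_n):X\to\mathbb R^n$ and $\vec h=(h_1,\dots,h_n):Y\to\mathbb R^n$ max-tame. Then for every $i\in\mathbb Z$ and every $j=1,\dots,n$, $$d\big(\rho^{f_j}_{X,i},\rho^{h_j}_{Y,i}\big)\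 \le\ D\big(\overline\rho^{\vec f}_{X,i},\overline\rho^{\vec h}_{Y,i}\big).$$ -/

import Mathlib

open CategoryTheory
open scoped ENNReal

universe u v w

noncomputable section

namespace MultiPersistence

/-! ### Lower level sets -/

/-- The lower level set `X⟨f ≤ a⟩`. It is used for `V = ℝ` and for `V = Fin n → ℝ`, where `≤` is
the coordinatewise order. -/
def sublevel {X : Type u} {V : Type*} [Preorder V] (f : X → V) (a : V) : Set X := {P | f P ≤ a}

theorem sublevel_mono {X : Type u} {V : Type*} [Preorder V] (f : X → V) {a b : V} (h : a ≤ b) :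
    sublevel f a ⊆ sublevel f b := fun _ hP => le_trans hP h

/-! ### Singular homology over a field, in all integer degrees -/

/-- The `i`-th singular homology functor with coefficients in `k`, for `i : ℤ`.
It is Mathlib's singular homology for `i ≥ 0` and zero for `i < 0`. The `ULift` only adjusts the
universe of the coefficient module. -/
def homologyFunctor (k : Type w) [Field k] : ℤ → TopCat.{u} ⥤ ModuleCat.{max u w} k
  | Int.ofNat m =>
      (AlgebraicTopology.singularHomologyFunctor (ModuleCat.{max u w} k) m).obj
        (ModuleCat.of k (ULift.{u} k))
  | Int.negSucc _ => (Functor.const _).obj (ModuleCat.of k PUnit)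

variable {X : Type u} [TopologicalSpace X] {Y : Type v} [TopologicalSpace Y]

/-- `H_i(A)` for a subset `A` of a space, with the subspace topology. -/
abbrev homology (k : Type w) [Field k] (i : ℤ) (A : Set X) : ModuleCat.{max u w} k :=
  (homologyFunctor.{u, w} k i).obj (TopCat.of A)

/-- The linear map `H_i(A) → H_i(B)` induced by an inclusion `A ⊆ B`. -/
def inclusionMap (k : Type w) [Field k] (i : ℤ) {A B : Set X} (h : A ⊆ B) :
    homology k i A →ₗ[k] homology k i B :=
  ((homologyFunctor.{u, w} k i).map
    (TopCat.ofHom ⟨Set.inclusion h, continuous_inclusion h⟩)).hom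

/-! ### Tame and max-tame functions -/

/-- `a` is a homological critical value of `f`: in some degree `i`, for all sufficiently small
`ε > 0`, the map `H_i(X⟨f ≤ a - ε⟩) → H_i(X⟨f ≤ a + ε⟩)` is not an isomorphism. -/
def IsHomologicalCriticalValue (k : Type w) [Field k] (f : X → ℝ) (a : ℝ) : Prop :=
  ∃ i : ℤ, ∃ ε₀ > 0, ∀ (ε : ℝ) (hε : 0 < ε), ε < ε₀ →
    ¬ Function.Bijective
      (inclusionMap k i (sublevel_mono f (by linarith : a - ε ≤ a + ε)))

/-- `f` is tame: it has finitely many homological critical values, and all its lower level sets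
have finite-dimensional homology in every degree. -/
def IsTame (k : Type w) [Field k] (f : X → ℝ) : Prop :=
  {a : ℝ | IsHomologicalCriticalValue k f a}.Finite ∧
    ∀ (i : ℤ) (a : ℝ), Module.Finite k (homology k i (sublevel f a))

/-- `(l, b)` is admissible: `l` is a (Euclidean) unit vector with positive coordinates and the
coordinates of `b` add up to zero. -/
def IsAdmissible {n : ℕ} (l b : Fin n → ℝ) : Prop :=
  ∑ j, l j ^ 2 = 1 ∧ (∀ j, 0 < l j) ∧ ∑ j, b j = 0

/-- The function `g(P) = max_j (f_j(P) - b_j) / l_j`. -/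
def maxFun {n : ℕ} (l b : Fin n → ℝ) (f : X → Fin n → ℝ) : X → ℝ :=
  fun P => ⨆ j, (f P j - b j) / l j

/-- `f` is max-tame: it is continuous, and for every admissible `(l, b)` the function
`max_j (f_j - b_j) / l_j` is tame. -/
def IsMaxTame (k : Type w) [Field k] {n : ℕ} (f : X → Fin n → ℝ) : Prop :=
  Continuous f ∧ ∀ l b : Fin n → ℝ, IsAdmissible l b → IsTame k (maxFun l b f)

/-! ### Rank invariants -/

open Classical in
/-- The `i`-th rank invariant `ρ(a, b)` of `f`, for `a ≤ b`: the rank of the persistent homology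
module `Im (H_i(X⟨f ≤ a⟩) → H_i(X⟨f ≤ b⟩))`. It is extended by zero to pairs without `a ≤ b`;
those values are never used below. -/
def rankInvariant (k : Type w) [Field k] (i : ℤ) {V : Type*} [Preorder V] (f : X → V)
    (a b : V) : ℕ :=
  if h : a ≤ b then
    Module.finrank k (LinearMap.range (inclusionMap k i (sublevel_mono f h)))
  else 0

/-! ### Persistence diagrams and the 1-dimensional matching distance -/

/-- The multiplicity of `(x, y)`, `x < y ≤ ∞`, as a cornerpoint of the rank invariant `ρ`:
for `y < ∞` it is the minimum over `ε > 0` with `x + ε < y - ε` of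
`ρ(x + ε, y - ε) - ρ(x - ε, y - ε) - ρ(x + ε, y + ε) + ρ(x - ε, y + ε)`;
for `y = ∞` it is the minimum over `ε > 0` and `t > x + ε` of `ρ(x + ε, t) - ρ(x - ε, t)`.
(If `y ≤ x` the set below is empty, and the value is `0`.) -/
def multiplicity (ρ : ℝ → ℝ → ℕ) (x : ℝ) : WithTop ℝ → ℕ
  | some y => sInf {m : ℕ | ∃ ε : ℝ, 0 < ε ∧ x + ε < y - ε ∧
      (m : ℤ) = ρ (x + ε) (y - ε) - ρ (x - ε) (y - ε) - ρ (x + ε) (y + ε) + ρ (x - ε) (y + ε)}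
  | none => sInf {m : ℕ | ∃ ε t : ℝ, 0 < ε ∧ x + ε < t ∧
      (m : ℤ) = ρ (x + ε) t - ρ (x - ε) t}

/-- The persistence diagram of `ρ`: each cornerpoint, repeated according to its multiplicity,
together with countably many points of the diagonal, one for each rational number. -/
def Diagram (ρ : ℝ → ℝ → ℕ) : Type :=
  (Σ p : ℝ × WithTop ℝ, Fin (multiplicity ρ p.1 p.2)) ⊕ ℚ

/-- The point of the extended plane underlying an element of a persistence diagram. -/
def Diagram.point {ρ : ℝ → ℝ → ℕ} : Diagram ρ → ℝ × WithTop ℝ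
  | Sum.inl c => c.1
  | Sum.inr q => ((q : ℝ), ((q : ℝ) : WithTop ℝ))

/-- `|y - y'|` on `(-∞, ∞]`, with values in `[0, ∞]`: `|∞ - ∞| = 0` and `|∞ - y| = ∞`. -/
def absDiff : WithTop ℝ → WithTop ℝ → ℝ≥0∞
  | some y, some y' => ENNReal.ofReal |y - y'|
  | none, none => 0
  | _, _ => ⊤

/-- `(y - x) / 2`, which is `∞` for `y = ∞`. -/
def halfPersistence (p : ℝ × WithTop ℝ) : ℝ≥0∞ := absDiff p.2 p.1 / 2

/-- The distance of two points of the extended plane: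
`δ((a, b), (c, d)) = min {max {|a - c|, |b - d|}, max {(b - a) / 2, (d - c) / 2}}`.
It takes the value `(b - a) / 2` whenever `c = d`, and `0` if moreover `a = b`, so it does not
matter which points of the diagonal a persistence diagram contains. -/
def cornerDist (p q : ℝ × WithTop ℝ) : ℝ≥0∞ :=
  min (max (absDiff p.1 q.1) (absDiff p.2 q.2)) (max (halfPersistence p) (halfPersistence q))

/-- The matching (bottleneck) distance: the infimum over all bijections `σ` of the supremum over
all `P` of `δ(P, σ(P))`. -/
def matchingDist (ρ₁ ρ₂ : ℝ → ℝ → ℕ) : ℝ≥0∞ :=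
  ⨅ σ : Diagram ρ₁ ≃ Diagram ρ₂, ⨆ P : Diagram ρ₁, cornerDist P.point (σ P).point

/-! ### The multidimensional matching distance -/

/-- On the half-plane of an admissible pair the rank invariant of `f` is the rank invariant of
`max_j (f_j - b_j) / l_j`; so the distance `multiMatchingDist` below depends only on the rank
invariants of `f` and `h`. -/
theorem rankInvariant_halfPlane (k : Type w) [Field k] (i : ℤ) {n : ℕ} {l b : Fin n → ℝ}
    (hlb : IsAdmissible l b) (f : X → Fin n → ℝ) {s t : ℝ} (hst : s < t) :
    rankInvariant k i f (s • l + b) (t • l + b) = rankInvariant k i (maxFun l b f) s t := by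
  have hn : Nonempty (Fin n) := by
    by_contra hne
    rw [not_nonempty_iff] at hne
    simpa using hlb.1
  have key : ∀ r : ℝ, sublevel f (r • l + b) = sublevel (maxFun l b f) r := by
    intro r
    ext P
    simp only [sublevel, maxFun, Set.mem_ofPred_eq, Pi.le_def, Pi.add_apply, Pi.smul_apply,
      smul_eq_mul]
    rw [ciSup_le_iff (Set.finite_range _).bddAbove]
    exact forall_congr' fun j => by rw [div_le_iff₀ (hlb.2.1 j), sub_le_iff_le_add]
  have hle : s • l + b ≤ t • l + b := fun j => by
    have := mul_le_mul_of_nonneg_right hst.le (hlb.2.1 j).le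
    simpa using this
  have aux : ∀ {A A' B B' : Set X} (_ : A = A') (_ : B = B') (h : A ⊆ B) (h' : A' ⊆ B'),
      Module.finrank k (LinearMap.range (inclusionMap k i h)) =
        Module.finrank k (LinearMap.range (inclusionMap k i h')) := by
    rintro A _ B _ rfl rfl h h'
    rfl
  simp only [rankInvariant, dif_pos hle, dif_pos hst.le]
  exact aux (key s) (key t) _ _

/-- The `i`-th multidimensional matching distance between the rank invariants of `f` and `h`:
the supremum over all admissible `(l, b)` of `min_j l_j` times the matching distance of the `i`-th
rank invariants of `max_j (f_j - b_j) / l_j` and `max_j (h_j - b_j) / l_j`. -/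
def multiMatchingDist (k : Type w) [Field k] (i : ℤ) {n : ℕ}
    (f : X → Fin n → ℝ) (h : Y → Fin n → ℝ) : ℝ≥0∞ :=
  ⨆ (l : Fin n → ℝ) (b : Fin n → ℝ) (_ : IsAdmissible l b),
    ENNReal.ofReal (⨅ j, l j) *
      matchingDist (rankInvariant k i (maxFun l b f)) (rankInvariant k i (maxFun l b h))

end MultiPersistence

end

open CategoryTheory
open scoped ENNReal

noncomputable section

namespace MultiPersistence

/-! ### Affine changes of coordinates of the extended plane -/

/-! The distance `multiMatchingDist` is a supremum, so it suffices to find one admissible pair whose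
term equals or exceeds the left-hand side. By compactness `f` and `h` are bounded, so for `l`
constant equal to `a = 1 / √n` and `b` very negative at `j`, the `j`-th term attains the maximum at
every point. Then `maxFun` is `a⁻¹ * f_j + d` on `X` and `a⁻¹ * h_j + d` on `Y`, with the same `d`
(`maxFun_eq_of_dominates`). An increasing affine change of parameter of slope `c` scales matching
distances by `c` (`mul_matchingDist_le`), and the weight `min l = a` cancels the slope `a⁻¹`. -/

/-- The affine bijection `x ↦ c * x + d` of the real line. -/
def affineEquiv (c d : ℝ) (hc : 0 < c) : ℝ ≃ ℝ where
  toFun x := c * x + d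
  invFun x := (x - d) / c
  left_inv x := by field_simp; ring
  right_inv x := by field_simp; ring

/-- The bijection of the extended plane which applies `x ↦ c * x + d` to both coordinates. -/
def planeEquiv (c d : ℝ) (hc : 0 < c) : ℝ × WithTop ℝ ≃ ℝ × WithTop ℝ :=
  (affineEquiv c d hc).prodCongr (affineEquiv c d hc).optionCongr

theorem planeEquiv_coe (c d : ℝ) (hc : 0 < c) (x y : ℝ) :
    planeEquiv c d hc (x, (y : WithTop ℝ)) = (c * x + d, ((c * y + d : ℝ) : WithTop ℝ)) := rfl

theorem planeEquiv_top (c d : ℝ) (hc : 0 < c) (x : ℝ) :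
    planeEquiv c d hc (x, (⊤ : WithTop ℝ)) = (c * x + d, (⊤ : WithTop ℝ)) := rfl

theorem absDiff_coe (x y : ℝ) :
    absDiff (x : WithTop ℝ) (y : WithTop ℝ) = ENNReal.ofReal |x - y| := rfl

theorem absDiff_coe_top (x : ℝ) : absDiff (x : WithTop ℝ) ⊤ = ⊤ := rfl

theorem absDiff_top_coe (x : ℝ) : absDiff ⊤ (x : WithTop ℝ) = ⊤ := rfl

theorem absDiff_top_top : absDiff ⊤ ⊤ = 0 := rfl

theorem absDiff_affine (c d : ℝ) (hc : 0 < c) (x y : ℝ) :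
    absDiff ((c * x + d : ℝ) : WithTop ℝ) ((c * y + d : ℝ) : WithTop ℝ) =
      ENNReal.ofReal c * absDiff x y := by
  rw [absDiff_coe, absDiff_coe, ← ENNReal.ofReal_mul hc.le]
  congr 1
  rw [show c * x + d - (c * y + d) = c * (x - y) by ring, abs_mul, abs_of_pos hc]

theorem halfPersistence_planeEquiv (c d : ℝ) (hc : 0 < c) (p : ℝ × WithTop ℝ) :
    halfPersistence (planeEquiv c d hc p) = ENNReal.ofReal c * halfPersistence p := by
  have h0 : ENNReal.ofReal c ≠ 0 := by simpa using hc
  obtain ⟨x, y⟩ := p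
  induction y using WithTop.recTopCoe with
  | top =>
    rw [planeEquiv_top]
    simp only [halfPersistence, absDiff_top_coe]
    simp [ENNReal.top_div, ENNReal.mul_top h0]
  | coe y =>
    rw [planeEquiv_coe]
    simp only [halfPersistence]
    rw [absDiff_affine c d hc, mul_div_assoc]

theorem absDiff_comm (x y : WithTop ℝ) : absDiff x y = absDiff y x := by
  induction x using WithTop.recTopCoe <;> induction y using WithTop.recTopCoe
  · rfl
  · rfl
  · rfl
  · rw [absDiff_coe, absDiff_coe, abs_sub_comm]

theorem cornerDist_comm (p q : ℝ × WithTop ℝ) : cornerDist p q = cornerDist q p := by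
  simp only [cornerDist, absDiff_comm (p.1 : WithTop ℝ), absDiff_comm p.2,
    max_comm (halfPersistence p)]

/-- The distance to a point of the diagonal does not depend on that point. -/
theorem cornerDist_diagonal (p : ℝ × WithTop ℝ) (q : ℝ) :
    cornerDist p (q, (q : WithTop ℝ)) = halfPersistence p := by
  obtain ⟨x, y⟩ := p
  have hq : halfPersistence (q, (q : WithTop ℝ)) = 0 := by simp [halfPersistence, absDiff_coe]
  -- The half-persistence realizes the minimum: by the triangle inequality, `|y - x| ≤ |x - q| + |y
  -- - q|`, which is at most twice the maximum of the two.
  rw [cornerDist, hq, max_eq_left zero_le, min_eq_right]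
  induction y using WithTop.recTopCoe with
  | top => simp [absDiff_top_coe]
  | coe y =>
    simp only [halfPersistence, absDiff_coe]
    rw [← ENNReal.ofReal_max, ← ENNReal.ofReal_ofNat 2,
      ← ENNReal.ofReal_div_of_pos (by norm_num)]
    apply ENNReal.ofReal_le_ofReal
    have h1 := le_max_left |x - q| |y - q|
    have h2 := le_max_right |x - q| |y - q|
    have h3 := abs_sub_le y q x
    rw [abs_sub_comm q x] at h3
    linarith

/-- All four ingredients scale by `c`, including infinite ones because `c ≠ 0`, and multiplication
by `c` is monotone, hence commutes with `min` and `max`. -/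
theorem cornerDist_planeEquiv (c d : ℝ) (hc : 0 < c) (p q : ℝ × WithTop ℝ) :
    cornerDist (planeEquiv c d hc p) (planeEquiv c d hc q) =
      ENNReal.ofReal c * cornerDist p q := by
  have h0 : ENNReal.ofReal c ≠ 0 := by simpa using hc
  have hmono : Monotone fun r : ℝ≥0∞ => ENNReal.ofReal c * r :=
    fun _ _ h => mul_le_mul_right h _
  have h1 : absDiff (planeEquiv c d hc p).1 (planeEquiv c d hc q).1 =
      ENNReal.ofReal c * absDiff p.1 q.1 := absDiff_affine c d hc p.1 q.1
  have h2 : absDiff (planeEquiv c d hc p).2 (planeEquiv c d hc q).2 =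
      ENNReal.ofReal c * absDiff p.2 q.2 := by
    obtain ⟨x, y⟩ := p
    obtain ⟨x', y'⟩ := q
    induction y using WithTop.recTopCoe <;> induction y' using WithTop.recTopCoe
    · simp [planeEquiv_top, absDiff_top_top]
    · simp only [planeEquiv_top, planeEquiv_coe, absDiff_top_coe, ENNReal.mul_top h0]
    · simp only [planeEquiv_top, planeEquiv_coe, absDiff_coe_top, ENNReal.mul_top h0]
    · exact absDiff_affine c d hc _ _
  rw [cornerDist, cornerDist, h1, h2, halfPersistence_planeEquiv, halfPersistence_planeEquiv]
  exact ((hmono.map_min).trans (congrArg₂ min hmono.map_max hmono.map_max)).symm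

/-! ### Persistence diagrams under an affine change of parameter -/

/-- The substitutions `ε ↦ c * ε` and `t ↦ c * t + d` identify the two sets of values whose infima
are taken. -/
theorem multiplicity_planeEquiv {ρ ρ' : ℝ → ℝ → ℕ} {c d : ℝ} (hc : 0 < c)
    (hρ : ∀ s t, ρ' (c * s + d) (c * t + d) = ρ s t) (p : ℝ × WithTop ℝ) :
    multiplicity ρ' (planeEquiv c d hc p).1 (planeEquiv c d hc p).2 =
      multiplicity ρ p.1 p.2 := by
  have hadd : ∀ x ε : ℝ, c * x + d + c * ε = c * (x + ε) + d := fun x ε => by ring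
  have hsub : ∀ x ε : ℝ, c * x + d - c * ε = c * (x - ε) + d := fun x ε => by ring
  have hlt : ∀ x y : ℝ, c * x + d < c * y + d ↔ x < y := fun x y => by
    rw [add_lt_add_iff_right, mul_lt_mul_iff_right₀ hc]
  obtain ⟨x, y⟩ := p
  rcases y with _ | y
  · change sInf {m : ℕ | ∃ ε t : ℝ, 0 < ε ∧ c * x + d + ε < t ∧
      (m : ℤ) = ρ' (c * x + d + ε) t - ρ' (c * x + d - ε) t} =
      sInf {m : ℕ | ∃ ε t : ℝ, 0 < ε ∧ x + ε < t ∧ (m : ℤ) = ρ (x + ε) t - ρ (x - ε) t}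
    congr 1
    ext m
    constructor
    · rintro ⟨ε, t, hε, ht, hm⟩
      obtain ⟨ε, rfl⟩ : ∃ ε', c * ε' = ε := ⟨ε / c, by field_simp⟩
      obtain ⟨t, rfl⟩ : ∃ t', c * t' + d = t := ⟨(t - d) / c, by field_simp; ring⟩
      simp only [hadd, hsub, hlt, hρ] at ht hm
      exact ⟨ε, t, pos_of_mul_pos_right hε hc.le, ht, hm⟩
    · rintro ⟨ε, t, hε, ht, hm⟩
      refine ⟨c * ε, c * t + d, mul_pos hc hε, ?_⟩
      simp only [hadd, hsub, hlt, hρ]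
      exact ⟨ht, hm⟩
  · change sInf {m : ℕ | ∃ ε : ℝ, 0 < ε ∧ c * x + d + ε < c * y + d - ε ∧
      (m : ℤ) = ρ' (c * x + d + ε) (c * y + d - ε) - ρ' (c * x + d - ε) (c * y + d - ε)
        - ρ' (c * x + d + ε) (c * y + d + ε) + ρ' (c * x + d - ε) (c * y + d + ε)} =
      sInf {m : ℕ | ∃ ε : ℝ, 0 < ε ∧ x + ε < y - ε ∧
      (m : ℤ) = ρ (x + ε) (y - ε) - ρ (x - ε) (y - ε) - ρ (x + ε) (y + ε) + ρ (x - ε) (y + ε)}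
    congr 1
    ext m
    constructor
    · rintro ⟨ε, hε, ht, hm⟩
      obtain ⟨ε, rfl⟩ : ∃ ε', c * ε' = ε := ⟨ε / c, by field_simp⟩
      simp only [hadd, hsub, hlt, hρ] at ht hm
      exact ⟨ε, pos_of_mul_pos_right hε hc.le, ht, hm⟩
    · rintro ⟨ε, hε, ht, hm⟩
      refine ⟨c * ε, mul_pos hc hε, ?_⟩
      simp only [hadd, hsub, hlt, hρ]
      exact ⟨ht, hm⟩

/-- The bijection of persistence diagrams induced by an affine change of parameter; it moves the
cornerpoints along and keeps the chosen points of the diagonal. -/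
def diagramEquiv {ρ ρ' : ℝ → ℝ → ℕ} {c d : ℝ} (hc : 0 < c)
    (hρ : ∀ s t, ρ' (c * s + d) (c * t + d) = ρ s t) : Diagram ρ ≃ Diagram ρ' :=
  (Equiv.sigmaCongr (planeEquiv c d hc)
    fun p => finCongr (multiplicity_planeEquiv hc hρ p).symm).sumCongr (Equiv.refl ℚ)

/-- Diagonal points are not moved along by `diagramEquiv`. This is harmless: the distance to a
diagonal point is the half-persistence of the other point, wherever the diagonal point lies. -/
theorem cornerDist_diagramEquiv {ρ₁ ρ₁' ρ₂ ρ₂' : ℝ → ℝ → ℕ} {c d : ℝ} (hc : 0 < c)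
    (h₁ : ∀ s t, ρ₁' (c * s + d) (c * t + d) = ρ₁ s t)
    (h₂ : ∀ s t, ρ₂' (c * s + d) (c * t + d) = ρ₂ s t) (P : Diagram ρ₁) (Q : Diagram ρ₂) :
    cornerDist (diagramEquiv hc h₁ P).point (diagramEquiv hc h₂ Q).point =
      ENNReal.ofReal c * cornerDist P.point Q.point := by
  rcases P with P | q <;> rcases Q with Q | r
  · exact cornerDist_planeEquiv c d hc P.1 Q.1
  · change cornerDist (planeEquiv c d hc P.1) ((r : ℝ), ((r : ℝ) : WithTop ℝ)) =
      ENNReal.ofReal c * cornerDist P.1 ((r : ℝ), ((r : ℝ) : WithTop ℝ))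
    rw [cornerDist_diagonal, cornerDist_diagonal, halfPersistence_planeEquiv]
  · change cornerDist ((q : ℝ), ((q : ℝ) : WithTop ℝ)) (planeEquiv c d hc Q.1) =
      ENNReal.ofReal c * cornerDist ((q : ℝ), ((q : ℝ) : WithTop ℝ)) Q.1
    rw [cornerDist_comm, cornerDist_diagonal, cornerDist_comm, cornerDist_diagonal,
      halfPersistence_planeEquiv]
  · change cornerDist ((q : ℝ), ((q : ℝ) : WithTop ℝ)) ((r : ℝ), ((r : ℝ) : WithTop ℝ)) =
      ENNReal.ofReal c *
        cornerDist ((q : ℝ), ((q : ℝ) : WithTop ℝ)) ((r : ℝ), ((r : ℝ) : WithTop ℝ))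
    rw [cornerDist_diagonal]
    simp [halfPersistence, absDiff_coe]

/-- An affine change of parameter with slope `c` multiplies the matching distance by `c`. -/
theorem mul_matchingDist_le {ρ₁ ρ₁' ρ₂ ρ₂' : ℝ → ℝ → ℕ} {c d : ℝ} (hc : 0 < c)
    (h₁ : ∀ s t, ρ₁' (c * s + d) (c * t + d) = ρ₁ s t)
    (h₂ : ∀ s t, ρ₂' (c * s + d) (c * t + d) = ρ₂ s t) :
    ENNReal.ofReal c * matchingDist ρ₁ ρ₂ ≤ matchingDist ρ₁' ρ₂' := by
  refine le_iInf fun σ => ?_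
  -- Conjugating `σ` by the affine bijections gives a matching of the original diagrams whose costs,
  -- multiplied by `c`, are those of `σ`.
  let τ : Diagram ρ₁ ≃ Diagram ρ₂ :=
    ((diagramEquiv hc h₁).trans σ).trans (diagramEquiv hc h₂).symm
  refine (mul_le_mul_right (iInf_le _ τ) _).trans ?_
  rw [ENNReal.mul_iSup]
  refine iSup_le fun P => le_iSup_of_le (diagramEquiv hc h₁ P) ?_
  rw [← cornerDist_diagramEquiv hc h₁ h₂]
  simp [τ]

/-! ### Rank invariants of affine images, and the choice of the admissible pair -/

theorem rankInvariant_affine (k : Type w) [Field k] (i : ℤ) {X : Type u} [TopologicalSpace X]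
    (g : X → ℝ) {c : ℝ} (hc : 0 < c) (d s t : ℝ) :
    rankInvariant k i (fun P => c * g P + d) (c * s + d) (c * t + d) =
      rankInvariant k i g s t := by
  have key : ∀ r : ℝ, sublevel (fun P => c * g P + d) (c * r + d) = sublevel g r := by
    intro r
    ext P
    simp only [sublevel, Set.mem_ofPred_eq]
    rw [add_le_add_iff_right, mul_le_mul_iff_right₀ hc]
  have hle : c * s + d ≤ c * t + d ↔ s ≤ t := by
    rw [add_le_add_iff_right, mul_le_mul_iff_right₀ hc]
  have aux : ∀ {A A' B B' : Set X} (_ : A = A') (_ : B = B') (h : A ⊆ B) (h' : A' ⊆ B'),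
      Module.finrank k (LinearMap.range (inclusionMap k i h)) =
        Module.finrank k (LinearMap.range (inclusionMap k i h')) := by
    rintro A _ B _ rfl rfl h h'
    rfl
  by_cases hst : s ≤ t
  · simp only [rankInvariant, dif_pos (hle.2 hst), dif_pos hst]
    exact aux (key s) (key t) _ _
  -- Both sides take the default value zero; this case is needed because the diagram lemmas ask for
  -- the identity at all `s`, `t`.
  · simp only [rankInvariant, dif_neg (mt hle.1 hst), dif_neg hst]

/-- If `b j` is so small that the `j`-th term always dominates, then `maxFun` is that term. -/
theorem maxFun_eq_of_dominates {X : Type u} [TopologicalSpace X] {n : ℕ} {a : ℝ} (ha : 0 < a)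
    {b : Fin n → ℝ} {f : X → Fin n → ℝ} {j : Fin n}
    (h : ∀ P m, f P m - b m ≤ f P j - b j) :
    maxFun (fun _ => a) b f = fun P => a⁻¹ * f P j + -(a⁻¹ * b j) := by
  funext P
  have : Nonempty (Fin n) := ⟨j⟩
  have hj : a⁻¹ * f P j + -(a⁻¹ * b j) = (f P j - b j) / a := by ring
  rw [hj]
  exact le_antisymm (ciSup_le fun m => div_le_div_of_nonneg_right (h P m) ha.le)
    (le_ciSup (f := fun m => (f P m - b m) / a) (Set.finite_range _).bddAbove j)

theorem exists_forall_abs_le {X : Type u} [TopologicalSpace X] [CompactSpace X] {n : ℕ}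
    {f : X → Fin n → ℝ} (hf : Continuous f) : ∃ C, ∀ P m, |f P m| ≤ C := by
  obtain ⟨C, hC⟩ := (isCompact_range hf).isBounded.exists_norm_le
  exact ⟨C, fun P m => (norm_le_pi_norm (f P) m).trans (hC _ ⟨P, rfl⟩)⟩

/-- The shift vector which equals `C` outside `j` and has coordinate sum zero. -/
def shiftVector {n : ℕ} (j : Fin n) (C : ℝ) : Fin n → ℝ :=
  fun m => C - if m = j then n * C else 0

theorem sum_shiftVector {n : ℕ} (j : Fin n) (C : ℝ) : ∑ m, shiftVector j C m = 0 := by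
  simp [shiftVector, Finset.sum_sub_distrib]

/-- For `m ≠ j` the shifts differ by `n * C ≥ C`, while two coordinates of `x` differ by at most
`C`. -/
theorem sub_shiftVector_le {n : ℕ} (j : Fin n) {C : ℝ} {x : Fin n → ℝ}
    (hx : ∀ m, |x m| ≤ C / 2) (m : Fin n) :
    x m - shiftVector j C m ≤ x j - shiftVector j C j := by
  rcases eq_or_ne m j with rfl | hm
  · exact le_rfl
  · have hC : 0 ≤ C := by linarith [(abs_nonneg _).trans (hx m)]
    have hn : (1 : ℝ) ≤ n := by exact_mod_cast j.pos
    have hnC : C ≤ n * C := le_mul_of_one_le_left hC hn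
    simp only [shiftVector, if_neg hm, if_true]
    linarith [(abs_le.1 (hx m)).2, (abs_le.1 (hx j)).1]

theorem isAdmissible_diagonal {n : ℕ} (hn : 0 < n) {b : Fin n → ℝ} (hb : ∑ m, b m = 0) :
    IsAdmissible (fun _ => (Real.sqrt n)⁻¹) b := by
  have hn' : (0 : ℝ) < n := by exact_mod_cast hn
  refine ⟨?_, fun _ => by positivity, hb⟩
  simp [inv_pow, Real.sq_sqrt hn'.le, hn'.ne']

end MultiPersistence

end

open MultiPersistence in
theorem proposition4p2 (k : Type w) [Field k]
    (X : Type u) [TopologicalSpace X] [Nonempty X] [CompactSpace X] [LocallyConnectedSpace X]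
    [T2Space X]
    (Y : Type v) [TopologicalSpace Y] [Nonempty Y] [CompactSpace Y] [LocallyConnectedSpace Y]
    [T2Space Y]
    (n : ℕ) (f : X → Fin n → ℝ) (h : Y → Fin n → ℝ)
    (hf : MultiPersistence.IsMaxTame k f) (hh : MultiPersistence.IsMaxTame k h)
    (i : ℤ) (j : Fin n) :
    MultiPersistence.matchingDist
        (MultiPersistence.rankInvariant k i (fun P => f P j))
        (MultiPersistence.rankInvariant k i (fun Q => h Q j)) ≤
      MultiPersistence.multiMatchingDist k i f h := by
  obtain ⟨Cf, hCf⟩ := exists_forall_abs_le hf.1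
  obtain ⟨Ch, hCh⟩ := exists_forall_abs_le hh.1
  have : Nonempty (Fin n) := ⟨j⟩
  have hn : (0 : ℝ) < n := by exact_mod_cast j.pos
  -- One constant for both functions, so that the same pair, and hence the same affine map, serves
  -- `f` and `h`; the factor 2 matches the bound `C / 2` in `sub_shiftVector_le`.
  set C : ℝ := 2 * max Cf Ch with hC
  set b := shiftVector j C
  set a : ℝ := (Real.sqrt n)⁻¹ with ha_def
  have ha : 0 < a := by positivity
  have hadm : IsAdmissible (fun _ => a) b := isAdmissible_diagonal j.pos (sum_shiftVector j C)
  have hf' := maxFun_eq_of_dominates (b := b) (f := f) (j := j) ha fun P =>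
    sub_shiftVector_le j fun m => (hCf P m).trans (by rw [hC]; linarith [le_max_left Cf Ch])
  have hh' := maxFun_eq_of_dominates (b := b) (f := h) (j := j) ha fun Q =>
    sub_shiftVector_le j fun m => (hCh Q m).trans (by rw [hC]; linarith [le_max_right Cf Ch])
  refine le_trans ?_ (le_iSup_of_le (fun _ => a) (le_iSup_of_le b (le_iSup_of_le hadm le_rfl)))
  rw [hf', hh', ciInf_const]
  -- Both rank invariants are reparametrized with slope `a⁻¹`; what remains is `a * a⁻¹ = 1`.
  refine le_trans (le_of_eq ?_) (mul_le_mul_right (mul_matchingDist_le (inv_pos.2 ha)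
    (rankInvariant_affine k i (fun P => f P j) (inv_pos.2 ha) _)
    (rankInvariant_affine k i (fun Q => h Q j) (inv_pos.2 ha) _)) _)
  rw [← mul_assoc, ← ENNReal.ofReal_mul ha.le, mul_inv_cancel₀ ha.ne', ENNReal.ofReal_one, one_mul]
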